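/- For $n\in\mathbb{N}$ let $N=2^n$ and $[N]=\{1,\dots,N\}$, and let $\mathrm{PL}_n\colon [N]^2\times\{-N^2,\dots,N^2\}^2\to\{0,1\}$ be the Point--Line Incidence function, $\mathrm{PL}_n((x,y),(a,b))=1$ if and only if $y=ax+b$. Let $\neg\mathrm{PL}_n=1-\mathrm{PL}_n$. For a function $f\colon\mathcal X\times\mathcal Y\to\{0,1\}$ with $\mathcal X,\mathcal Y$ finite, the support-rank $\mathrm{rank}_0(f)$ is the smallest $r\in\mathbb{N}$ for which there are maps $\phi\colon\mathcal X\to\mathbb{R}^r$ and $\psi\colon\mathcal Y\to\mathbb{R}^r$ such that for all $x,y$: $f(x,y)=0\iff\langle\phi(x),\psi(y)\rangle=0$. The public-coin randomised communication complexity $\mathsf{R}(f)$ is the smallest $c\in\mathbb{N}$ for which there is a probability distribution over deterministic two-party protocols that each communicate at most $c$ bits in the worst case, such that for every input $(x,y)$ the output of the random protocol equals $f(x,y)$ with probability at least $2/3$. Corollary. There is a family of two-party functions with support-rank at most $3$ but super-constant public-coin randomised communication complexity, namely $(\neg\mathrm{PL}_n)_{n\in\mathbb{N}}$: (i) for every $n$,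 the embeddings $\phi(x,y)=(x,y,1)$ and $\psi(a,b)=(a,-1,b)$ into $\mathbb{R}^3$ satisfy $\neg\mathrm{PL}_n((x,y),(a,b))=0\iff\langle\phi(x,y),\psi(a,b)\rangle=0$ for all inputs; hence $\mathrm{rank}_0(\neg\mathrm{PL}_n)\le 3$; (ii) $\mathsf{R}(\neg\mathrm{PL}_n)\ge\omega(1)$, that is, $\mathsf{R}(\neg\mathrm{PL}_n)\to\infty$ as $n\to\infty$. -/

import Mathlib

/-- A deterministic two-party communication protocol: at every internal node one of the two
parties sends one bit, a function of that party's input only; a leaf holds the output. -/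
inductive Protocol (X Y : Type*) where
  | leaf (out : Bool) : Protocol X Y
  | alice (msg : X → Bool) (next₀ next₁ : Protocol X Y) : Protocol X Y
  | bob (msg : Y → Bool) (next₀ next₁ : Protocol X Y) : Protocol X Y

namespace Protocol

/-- The output of the protocol on the input pair `(x, y)`. -/
def eval {X Y : Type*} : Protocol X Y → X → Y → Bool
  | leaf out, _, _ => out
  | alice msg next₀ next₁, x, y => if msg x then next₁.eval x y else next₀.eval x y
  | bob msg next₀ next₁, x, y => if msg y then next₁.eval x y else next₀.eval x y

/-- The worst-case number of bits sent: the depth of the protocol tree. -/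
def cost {X Y : Type*} : Protocol X Y → ℕ
  | leaf _ => 0
  | alice _ next₀ next₁ => max next₀.cost next₁.cost + 1
  | bob _ next₀ next₁ => max next₀.cost next₁.cost + 1

end Protocol

/-- `f` has a public-coin randomised protocol of cost at most `c`: a probability distribution `μ`
over deterministic protocols of cost at most `c` such that on every input pair the output is
correct with probability at least `2 / 3`. -/
def HasPublicCoinProtocol {X Y : Type*} (f : X → Y → Bool) (c : ℕ) : Prop :=
  ∃ μ : PMF (Protocol X Y),
    (∀ P ∈ μ.support, P.cost ≤ c) ∧
    ∀ (x : X) (y : Y), (2 / 3 : ENNReal) ≤ μ.toOuterMeasure {P | P.eval x y = f x y}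

/-- Every function with a finite input set for Alice is computed by some protocol. -/
theorem exists_hasPublicCoinProtocol {X Y : Type*} [Finite X] (f : X → Y → Bool) :
    ∃ c, HasPublicCoinProtocol f c := by
  classical
  have key : ∀ l : List X, ∃ P : Protocol X Y, ∀ x ∈ l, ∀ y, P.eval x y = f x y := by
    intro l
    induction l with
    | nil => exact ⟨.leaf false, by simp⟩
    | cons a l ih =>
      obtain ⟨P, hP⟩ := ih
      refine ⟨.alice (fun x => decide (x = a)) P (.bob (f a) (.leaf false) (.leaf true)), ?_⟩
      intro x hx y
      by_cases h : x = a
      · subst h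
        cases hf : f x y <;> simp [Protocol.eval, hf]
      · have hx' : x ∈ l := by simpa [h] using hx
        simp [Protocol.eval, h, hP x hx' y]
  have := Fintype.ofFinite X
  obtain ⟨P, hP⟩ := key (Finset.univ : Finset X).toList
  refine ⟨P.cost, PMF.pure P, by simp, fun x y => ?_⟩
  have h : P.eval x y = f x y := hP x (by simp) y
  rw [PMF.toOuterMeasure_pure_apply, if_pos (by simpa using h)]
  exact ENNReal.div_le_of_le_mul (by norm_num)

/-- The public-coin randomised communication complexity of `f`. -/
noncomputable def randCC {X Y : Type*} (f : X → Y → Bool) : ℕ :=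
  sInf {c | HasPublicCoinProtocol f c}

/-- The embeddings `φ`, `ψ` represent `f` by linear equalities in dimension `r`. -/
def IsSupportRep {X Y : Type*} (f : X → Y → Bool) {r : ℕ}
    (φ : X → Fin r → ℝ) (ψ : Y → Fin r → ℝ) : Prop :=
  ∀ (x : X) (y : Y), f x y = false ↔ φ x ⬝ᵥ ψ y = 0

/-- The support-rank of `f`: the smallest dimension in which `f` can be represented by linear
equalities (`⊤` if there is none, which cannot happen for finite `X` and `Y`). -/
noncomputable def supportRank {X Y : Type*} (f : X → Y → Bool) : ℕ∞ :=
  sInf {s : ℕ∞ | ∃ (r : ℕ) (φ : X → Fin r → ℝ) (ψ : Y → Fin r → ℝ),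
    s = r ∧ IsSupportRep f φ ψ}

/-- Alice's inputs: the points `(x, y) ∈ [N]²`, where `N = 2 ^ n` and `[N] = {1, …, N}`. -/
abbrev PLPoint (n : ℕ) : Type :=
  Set.Icc (1 : ℤ) (2 ^ n) × Set.Icc (1 : ℤ) (2 ^ n)

/-- Bob's inputs: the line parameters `(a, b) ∈ {-N², …, N²}²`, where `N = 2 ^ n`. -/
abbrev PLLine (n : ℕ) : Type :=
  Set.Icc (-((2 : ℤ) ^ n) ^ 2) (((2 : ℤ) ^ n) ^ 2) ×
    Set.Icc (-((2 : ℤ) ^ n) ^ 2) (((2 : ℤ) ^ n) ^ 2)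

/-- Point--Line Incidence: `PL n (x, y) (a, b) = 1` iff `y = a x + b`. -/
def PL (n : ℕ) (p : PLPoint n) (l : PLLine n) : Bool :=
  decide ((p.2 : ℤ) = (l.1 : ℤ) * (p.1 : ℤ) + (l.2 : ℤ))

/-- The negation of Point--Line Incidence. -/
def negPL (n : ℕ) (p : PLPoint n) (l : PLLine n) : Bool :=
  !PL n p l

/-- The embedding `(x, y) ↦ (x, y, 1)` of Alice's inputs. -/
def pointEmbedding (n : ℕ) (p : PLPoint n) : Fin 3 → ℝ :=
  ![((p.1 : ℤ) : ℝ), ((p.2 : ℤ) : ℝ), 1]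

/-- The embedding `(a, b) ↦ (a, -1, b)` of Bob's inputs. -/
def lineEmbedding (n : ℕ) (l : PLLine n) : Fin 3 → ℝ :=
  ![((l.1 : ℤ) : ℝ), -1, ((l.2 : ℤ) : ℝ)]

open Finset in
/-- A protocol restricted to a rectangle inherits a discrepancy bound on rectangles, with a
loss of at most a factor two for every bit sent. -/
theorem Protocol.abs_sum_eval_le {X Y ι : Type*} (s : Finset ι) (w : ι → ℝ) (u : ι → X)
    (v : ι → Y) (B : ℝ)
    (hB : ∀ (p : X → Bool) (q : Y → Bool),
      |∑ i ∈ s, w i * (if p (u i) && q (v i) then 1 else 0)| ≤ B)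
    (P : Protocol X Y) (p : X → Bool) (q : Y → Bool) :
    |∑ i ∈ s, w i * (if p (u i) && q (v i) && P.eval (u i) (v i) then 1 else 0)|
      ≤ 2 ^ P.cost * B := by
  have hB0 : 0 ≤ B := (abs_nonneg _).trans (hB (fun _ => true) (fun _ => true))
  have combine : ∀ (m k : ℕ) (S T : ℝ), |S| ≤ 2 ^ m * B → |T| ≤ 2 ^ k * B →
      |S + T| ≤ 2 ^ (max m k + 1) * B := by
    intro m k S T hS hT
    have h1 : (2 : ℝ) ^ m * B ≤ 2 ^ max m k * B := by
      gcongr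
      · norm_num
      · exact le_max_left _ _
    have h2 : (2 : ℝ) ^ k * B ≤ 2 ^ max m k * B := by
      gcongr
      · norm_num
      · exact le_max_right _ _
    have h3 := abs_add_le S T
    rw [pow_succ]
    linarith
  induction P generalizing p q with
  | leaf out =>
    cases out
    · simpa [Protocol.eval, Protocol.cost] using hB0
    · simpa [Protocol.eval, Protocol.cost] using hB p q
  | alice msg P₀ P₁ ih₀ ih₁ =>
    have h := combine _ _ _ _ (ih₀ (fun x => p x && !msg x) q) (ih₁ (fun x => p x && msg x) q)
    rw [← sum_add_distrib] at h
    refine le_of_eq_of_le ?_ h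
    congr 1
    refine sum_congr rfl fun i _ => ?_
    cases hm : msg (u i) <;> simp [Protocol.eval, hm]
  | bob msg P₀ P₁ ih₀ ih₁ =>
    have h := combine _ _ _ _ (ih₀ p (fun y => q y && !msg y)) (ih₁ p (fun y => q y && msg y))
    rw [← sum_add_distrib] at h
    refine le_of_eq_of_le ?_ h
    congr 1
    refine sum_congr rfl fun i _ => ?_
    cases hm : msg (v i) <;> simp [Protocol.eval, hm]

/-- If every event of a finite family has probability at least `r`, then some outcome lies in
at least a fraction `r` of the events. -/
theorem PMF.exists_mem_support_mul_card_le {α ι : Type*} (μ : PMF α) (s : Finset ι)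
    (E : ι → Set α) (r : ENNReal) (hr : r ≠ ⊤) (hE : ∀ i ∈ s, r ≤ μ.toOuterMeasure (E i)) :
    ∃ a ∈ μ.support, r * s.card ≤ ∑ i ∈ s, (E i).indicator 1 a := by
  by_contra! hcon
  have hle : r * s.card ≤ ∑' a, μ a * ∑ i ∈ s, (E i).indicator 1 a := by
    calc r * s.card = ∑ i ∈ s, r := by simp [mul_comm]
      _ ≤ ∑ i ∈ s, μ.toOuterMeasure (E i) := Finset.sum_le_sum hE
      _ = ∑' a, ∑ i ∈ s, (E i).indicator μ a := by
        simp only [PMF.toOuterMeasure_apply]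
        exact (Summable.tsum_finsetSum fun _ _ => ENNReal.summable).symm
      _ = _ := by
        refine tsum_congr fun a => ?_
        rw [Finset.mul_sum]
        refine Finset.sum_congr rfl fun i _ => ?_
        by_cases h : a ∈ E i <;> simp [h]
  have hfin : r * s.card ≠ ⊤ := ENNReal.mul_ne_top hr (by simp)
  obtain ⟨a₀, ha₀⟩ := μ.support_nonempty
  have hpt : ∀ a, μ a * ∑ i ∈ s, (E i).indicator 1 a ≤ μ a * (r * s.card) := by
    intro a
    by_cases ha : a ∈ μ.support
    · exact mul_le_mul_right (hcon a ha).le _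
    · simp [(PMF.apply_eq_zero_iff μ a).2 ha]
  have htot : ∑' a, μ a * (r * s.card) = r * s.card := by
    rw [ENNReal.tsum_mul_right, μ.tsum_coe, one_mul]
  have hlt : ∑' a, μ a * ∑ i ∈ s, (E i).indicator 1 a < ∑' a, μ a * (r * s.card) := by
    refine ENNReal.tsum_lt_tsum (i := a₀) ?_ hpt ?_
    · exact ne_top_of_le_ne_top (by rwa [htot]) (ENNReal.tsum_le_tsum hpt)
    · rw [ENNReal.mul_lt_mul_iff_right ((PMF.mem_support_iff _ _).1 ha₀) (μ.apply_ne_top a₀)]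
      exact hcon a₀ ha₀
  rw [htot] at hlt
  exact absurd hle (not_le.2 hlt)

open Finset in
/-- The discrepancy lower bound on public-coin protocols: if no rectangle distinguishes a family
of zeros of `f` from a family of ones of `f`, then `f` has no cheap protocol. -/
theorem HasPublicCoinProtocol.card_le_of_discrepancy {X Y ι : Type*} {f : X → Y → Bool} {c : ℕ}
    (hf : HasPublicCoinProtocol f c) (s : Finset ι) (u : ι → X) (v₀ v₁ : ι → Y) (B : ℝ)
    (h₀ : ∀ i ∈ s, f (u i) (v₀ i) = false) (h₁ : ∀ i ∈ s, f (u i) (v₁ i) = true)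
    (hB : ∀ (p : X → Bool) (q : Y → Bool), |∑ i ∈ s, (if p (u i) then 1 else 0) *
      ((if q (v₀ i) then 1 else 0) - (if q (v₁ i) then 1 else 0) : ℝ)| ≤ B) :
    (s.card : ℝ) / 3 ≤ 2 ^ c * B := by
  have hB0 : 0 ≤ B := (abs_nonneg _).trans (hB (fun _ => true) (fun _ => true))
  obtain ⟨μ, hcost, hμ⟩ := hf
  obtain ⟨P, hP, hcount⟩ := μ.exists_mem_support_mul_card_le (s.disjSum s)
    (Sum.elim (fun i => {P | P.eval (u i) (v₀ i) = f (u i) (v₀ i)})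
      (fun i => {P | P.eval (u i) (v₁ i) = f (u i) (v₁ i)})) (2 / 3)
    (ENNReal.div_ne_top (by simp) (by simp)) (by rintro (i | i) _ <;> exact hμ _ _)
  have hdisc := P.abs_sum_eval_le (s.disjSum s) (Sum.elim (fun _ => 1) (fun _ => -1))
    (Sum.elim u u) (Sum.elim v₀ v₁) B (by
      intro p q
      refine le_of_eq_of_le ?_ (hB p q)
      rw [sum_disjSum, ← sum_add_distrib]
      congr 1
      refine sum_congr rfl fun i _ => ?_
      simp only [Sum.elim_inl, Sum.elim_inr]
      by_cases hp : p (u i) = true <;> by_cases h₀ : q (v₀ i) = true <;>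
        by_cases h₁ : q (v₁ i) = true <;> simp [hp, h₀, h₁]) (fun _ => true) (fun _ => true)
  have hreal : (2 / 3 : ℝ) * (s.card + s.card) ≤
      ∑ i ∈ s, ((if P.eval (u i) (v₀ i) then 0 else 1) +
        (if P.eval (u i) (v₁ i) then 1 else 0) : ℝ) := by
    have hne : ∀ E : Set (Protocol X Y), E.indicator (1 : Protocol X Y → ENNReal) P ≠ ⊤ :=
      fun E => by by_cases hPE : P ∈ E <;> simp [hPE]
    rw [sum_disjSum, ← sum_add_distrib] at hcount
    have h := ENNReal.toReal_mono
      (ENNReal.sum_ne_top.2 fun i _ => ENNReal.add_ne_top.2 ⟨hne _, hne _⟩) hcount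
    rw [ENNReal.toReal_sum fun i _ => ENNReal.add_ne_top.2 ⟨hne _, hne _⟩] at h
    simp only [card_disjSum, ENNReal.toReal_mul, ENNReal.toReal_div, ENNReal.toReal_ofNat,
      ENNReal.toReal_natCast] at h
    rw [Nat.cast_add] at h
    refine h.trans (sum_le_sum fun i hi => le_of_eq ?_)
    simp only [Sum.elim_inl, Sum.elim_inr, Set.indicator_apply, Set.mem_ofPred_eq, h₀ i hi,
      h₁ i hi]
    by_cases hP₀ : P.eval (u i) (v₀ i) = true <;> by_cases hP₁ : P.eval (u i) (v₁ i) = true <;>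
      simp [hP₀, hP₁]
    norm_num
  have hpow : (2 : ℝ) ^ P.cost * B ≤ 2 ^ c * B := by
    gcongr
    · norm_num
    · exact hcost P hP
  have hrel : ∑ i ∈ s, ((if P.eval (u i) (v₀ i) then 0 else 1) +
        (if P.eval (u i) (v₁ i) then 1 else 0) : ℝ) = s.card -
      ∑ i ∈ s, ((if P.eval (u i) (v₀ i) then 1 else 0) -
        (if P.eval (u i) (v₁ i) then 1 else 0) : ℝ) := by
    rw [card_eq_sum_ones, Nat.cast_sum, ← sum_sub_distrib]
    refine sum_congr rfl fun i _ => ?_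
    cases P.eval (u i) (v₀ i) <;> simp
  rw [sum_disjSum, ← sum_add_distrib] at hdisc
  simp only [Sum.elim_inl, Sum.elim_inr, Bool.true_and, one_mul, neg_one_mul,
    ← sub_eq_add_neg] at hdisc
  have := neg_le_of_abs_le hdisc
  linarith

/-- Shifting a sum over an interval by `m` changes it by at most `2 |m|` times the sup norm. -/
theorem abs_sum_range_sub_shift_le (φ : ℤ → ℝ) (hφ : ∀ x, |φ x| ≤ 1) (X : ℕ) (m : ℤ) :
    |∑ i ∈ Finset.range X, (φ i - φ (i - m))| ≤ 2 * |(m : ℝ)| := by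
  have nonneg_case : ∀ (k : ℕ) (φ : ℤ → ℝ), (∀ x, |φ x| ≤ 1) →
      |∑ i ∈ Finset.range X, (φ i - φ (i - k))| ≤ 2 * k := by
    intro k
    induction k with
    | zero => intro φ _; simp
    | succ k ih =>
      intro φ hφ
      have htel : ∑ i ∈ Finset.range X, (φ (i - k) - φ (i - (k + 1 : ℕ))) =
          φ (X - (k + 1 : ℕ)) - φ (0 - (k + 1 : ℕ)) := by
        have := Finset.sum_range_sub (fun i : ℕ => φ (i - (k + 1 : ℕ))) X
        rw [Nat.cast_zero] at this
        rw [← this]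
        refine Finset.sum_congr rfl fun i _ => ?_
        congr 2
        push_cast
        ring
      have hsplit : ∑ i ∈ Finset.range X, (φ i - φ (i - (k + 1 : ℕ))) =
          ∑ i ∈ Finset.range X, (φ i - φ (i - k)) +
          ∑ i ∈ Finset.range X, (φ (i - k) - φ (i - (k + 1 : ℕ))) := by
        rw [← Finset.sum_add_distrib]
        exact Finset.sum_congr rfl fun i _ => by ring
      rw [hsplit, htel]
      have h1 := ih φ hφ
      have h2 := abs_add_le (∑ i ∈ Finset.range X, (φ i - φ (i - k)))
        (φ (X - (k + 1 : ℕ)) - φ (0 - (k + 1 : ℕ)))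
      have h3 := abs_sub (φ (X - (k + 1 : ℕ))) (φ (0 - (k + 1 : ℕ)))
      have h4 := hφ (X - (k + 1 : ℕ))
      have h5 := hφ (0 - (k + 1 : ℕ))
      push_cast at *
      linarith
  obtain ⟨k, rfl | rfl⟩ := m.eq_nat_or_neg
  · simpa using nonneg_case k φ hφ
  · have h := nonneg_case k (fun x => φ (x + k)) fun x => hφ _
    rw [← abs_neg, ← Finset.sum_neg_distrib] at h
    simpa using h

open Finset in
/-- Reindexing a finite sum over the integers along a translation. -/
theorem sum_eq_sum_translate (S T : Finset ℤ) (r : ℤ) (D φ : ℤ → ℝ)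
    (hD : ∀ b ∉ S, D b = 0) (hST : ∀ b ∈ S, b + r ∈ T) :
    ∑ y ∈ T, D (y - r) * φ y = ∑ b ∈ S, D b * φ (b + r) := by
  have hmap := sum_map S (addRightEmbedding r) (fun y => D (y - r) * φ y)
  simp only [addRightEmbedding_apply, add_sub_cancel_right] at hmap
  rw [← hmap]
  symm
  refine sum_subset ?_ fun y _ hy => ?_
  · intro y hy
    obtain ⟨b, hb, rfl⟩ := mem_map.1 hy
    exact hST b hb
  · rw [hD, zero_mul]
    intro h
    exact hy (mem_map.2 ⟨y - r, h, by simp⟩)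

open Finset in
/-- The key estimate: no pair of bounded functions `f` of the point and `g` of the line
correlates with the difference between the incidences `y = a x + b` and `y = a x + b + K!`,
where the slopes `a` range over an interval of length `K`. -/
theorem sq_sum_incidence_sub_le (K X N : ℕ) (hN : K * X + K.factorial ≤ N)
    (f g : ℤ → ℤ → ℝ) (hf : ∀ x y, |f x y| ≤ 1) (hg : ∀ a b, |g a b| ≤ 1)
    (hg0 : ∀ a b, b ∉ Icc (-(N : ℤ)) N → g a b = 0) :
    (∑ x ∈ range X, ∑ y ∈ Icc (1 : ℤ) N, ∑ a ∈ range K, f x y *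
      (g a (y - (a + 1) * (x + 1)) - g a (y - (a + 1) * (x + 1) - K.factorial))) ^ 2 ≤
      (X * N : ℝ) * ((4 * N + 1) * (4 * K * X + 4 * K ^ 2 * K.factorial)) := by
  set M : ℕ := K.factorial
  set D : ℤ → ℤ → ℝ := fun a b => g a b - g a (b - M) with hDdef
  have hD2 : ∀ a b, |D a b| ≤ 2 := fun a b => by
    have h1 := abs_sub (g a b) (g a (b - M))
    have h2 := hg a b
    have h3 := hg a (b - M)
    linarith
  set S : Finset ℤ := Icc (-(2 * N : ℤ)) (2 * N)
  set T : Finset ℤ := Icc (-(3 * N : ℤ)) (3 * N)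
  have hMN : M ≤ N := (Nat.le_add_left _ _).trans hN
  have hDS : ∀ a, ∀ b ∉ S, D a b = 0 := by
    intro a b hb
    simp only [S, mem_Icc, not_and_or, not_le] at hb
    simp only [hDdef]
    rw [hg0 a b (by simp only [mem_Icc]; omega), hg0 a (b - M) (by simp only [mem_Icc]; omega),
      sub_zero]
  have hScard : (S.card : ℝ) = 4 * N + 1 := by
    have : S.card = 4 * N + 1 := by simp only [S, Int.card_Icc]; omega
    rw [this]; push_cast; ring
  have hcs : (∑ x ∈ range X, ∑ y ∈ Icc (1 : ℤ) N, ∑ a ∈ range K,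
      f x y * D a (y - (a + 1) * (x + 1))) ^ 2 ≤
      (X * N : ℝ) * ∑ x ∈ range X, ∑ y ∈ T, (∑ a ∈ range K, D a (y - (a + 1) * (x + 1))) ^ 2 := by
    simp only [← mul_sum]
    rw [← sum_product' (range X) (Icc (1 : ℤ) N)
      (fun x y => f x y * ∑ a ∈ range K, D a (y - (a + 1) * (x + 1)))]
    refine (sum_mul_sq_le_sq_mul_sq _ _ _).trans ?_
    refine mul_le_mul ?_ ?_ (sum_nonneg fun _ _ => sq_nonneg _) (by positivity)
    · have : ∀ z ∈ range X ×ˢ Icc (1 : ℤ) N, f z.1 z.2 ^ 2 ≤ 1 := fun z _ =>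
        (sq_le_one_iff_abs_le_one _).2 (hf _ _)
      refine (sum_le_card_nsmul _ _ 1 this).trans (le_of_eq ?_)
      simp
    · rw [sum_product' (range X) (Icc (1 : ℤ) N)
        (fun x y => (∑ a ∈ range K, D a (y - (a + 1) * (x + 1))) ^ 2)]
      refine sum_le_sum fun x _ => sum_le_sum_of_subset_of_nonneg ?_ fun _ _ _ => sq_nonneg _
      exact Icc_subset_Icc (by omega) (by omega)
  refine hcs.trans (mul_le_mul_of_nonneg_left ?_ (by positivity))
  have hexpand : ∑ x ∈ range X, ∑ y ∈ T, (∑ a ∈ range K, D a (y - (a + 1) * (x + 1))) ^ 2 =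
      ∑ a ∈ range K, ∑ a' ∈ range K, ∑ b ∈ S, D a b *
        ∑ x ∈ range X, D a' (b + (a - a') * (x + 1)) := by
    have h1 : ∀ x ∈ range X, ∑ y ∈ T, (∑ a ∈ range K, D a (y - (a + 1) * (x + 1))) ^ 2 =
        ∑ a ∈ range K, ∑ a' ∈ range K, ∑ b ∈ S, D a b * D a' (b + (a - a') * (x + 1)) := by
      intro x hx
      simp only [sq, sum_mul_sum]
      rw [sum_comm]
      refine sum_congr rfl fun a ha => ?_
      rw [sum_comm]
      refine sum_congr rfl fun a' _ => ?_
      rw [sum_eq_sum_translate S T ((a + 1) * (x + 1)) (D a)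
        (fun y => D a' (y - (a' + 1) * (x + 1))) (hDS a)]
      · refine sum_congr rfl fun b _ => ?_
        congr 2
        ring
      · intro b hb
        have hax : (a + 1) * (x + 1) ≤ K * X :=
          Nat.mul_le_mul (mem_range.1 ha) (mem_range.1 hx)
        have hax' : ((a : ℤ) + 1) * (x + 1) ≤ N := by exact_mod_cast (by omega : _ ≤ N)
        have hax0 : 0 ≤ ((a : ℤ) + 1) * (x + 1) := by positivity
        simp only [S, T, mem_Icc] at hb ⊢
        omega
    rw [sum_congr rfl h1, sum_comm]
    refine sum_congr rfl fun a _ => ?_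
    rw [sum_comm]
    refine sum_congr rfl fun a' _ => ?_
    rw [sum_comm]
    exact sum_congr rfl fun b _ => (mul_sum _ _ _).symm
  rw [hexpand]
  have hterm : ∀ a ∈ range K, ∀ a' ∈ range K, ∑ b ∈ S, D a b *
      ∑ x ∈ range X, D a' (b + (a - a') * (x + 1)) ≤
      (4 * N + 1) * ((if a = a' then 4 * (X : ℝ) else 0) + 4 * M) := by
    intro a ha a' ha'
    rw [← hScard, ← nsmul_eq_mul]
    refine sum_le_card_nsmul _ _ _ fun b _ => ?_
    refine (le_abs_self _).trans ?_
    rw [abs_mul]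
    have hinner : |∑ x ∈ range X, D a' (b + (a - a') * (x + 1))| ≤
        (if a = a' then 2 * (X : ℝ) else 0) + 2 * M := by
      split_ifs with h
      · refine (abs_sum_le_sum_abs _ _).trans ?_
        refine (sum_le_card_nsmul _ _ 2 fun _ _ => hD2 _ _).trans ?_
        have : (0 : ℝ) ≤ M := by positivity
        simp only [card_range, nsmul_eq_mul]
        linarith
      · have hdvd : ((a : ℤ) - a') ∣ M := by
          rw [← Int.natAbs_dvd]
          have ha := mem_range.1 ha
          have ha' := mem_range.1 ha'
          exact Int.natCast_dvd_natCast.2 (Nat.dvd_factorial (by omega) (by omega))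
        obtain ⟨m, hm⟩ := hdvd
        have hmM : |(m : ℝ)| ≤ M := by
          have h1 : |m| ≤ |(M : ℤ)| := by
            rw [hm, abs_mul]
            exact le_mul_of_one_le_left (abs_nonneg _) (Int.one_le_abs (by omega))
          rw [Nat.abs_cast] at h1
          exact_mod_cast h1
        have hs := abs_sum_range_sub_shift_le (fun x => g a' (b + (a - a') * (x + 1)))
          (fun _ => hg _ _) X m
        have heq : ∑ x ∈ range X, D a' (b + (a - a') * (x + 1)) = ∑ x ∈ range X,
            (g a' (b + (a - a') * (x + 1)) - g a' (b + (a - a') * ((x - m : ℤ) + 1))) := by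
          refine sum_congr rfl fun x _ => ?_
          simp only [hDdef, hm]
          congr 2
          ring
        rw [heq]
        linarith
    calc |D a b| * |∑ x ∈ range X, D a' (b + (a - a') * (x + 1))|
        ≤ 2 * ((if a = a' then 2 * (X : ℝ) else 0) + 2 * M) :=
          mul_le_mul (hD2 _ _) hinner (abs_nonneg _) (by norm_num)
      _ = _ := by split_ifs <;> ring
  refine (sum_le_sum fun a ha => sum_le_sum (hterm a ha)).trans (le_of_eq ?_)
  simp only [← mul_sum, sum_add_distrib, sum_ite_eq, mem_range, sum_const, card_range,
    nsmul_eq_mul]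
  rw [sum_congr rfl fun a ha => if_pos (mem_range.1 ha)]
  simp only [sum_const, card_range, nsmul_eq_mul]
  ring

/-- The point `(x, y)`, with both coordinates clamped to the admissible range. -/
noncomputable def clampPoint (n : ℕ) (x y : ℤ) : PLPoint n :=
  have h : (1 : ℤ) ≤ 2 ^ n := one_le_pow₀ (by norm_num)
  (Set.projIcc 1 (2 ^ n) h x, Set.projIcc 1 (2 ^ n) h y)

/-- The line `(a, b)`, with both parameters clamped to the admissible range. -/
noncomputable def clampLine (n : ℕ) (a b : ℤ) : PLLine n :=
  have h : -((2 : ℤ) ^ n) ^ 2 ≤ (2 ^ n) ^ 2 := neg_le_self (by positivity)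
  (Set.projIcc _ _ h a, Set.projIcc _ _ h b)

theorem negPL_clamp (n : ℕ) {x y a b : ℤ} (hx : x ∈ Set.Icc (1 : ℤ) (2 ^ n))
    (hy : y ∈ Set.Icc (1 : ℤ) (2 ^ n)) (ha : a ∈ Set.Icc (-(2 ^ n : ℤ)) (2 ^ n))
    (hb : b ∈ Set.Icc (-(2 ^ n : ℤ)) (2 ^ n)) :
    negPL n (clampPoint n x y) (clampLine n a b) = !decide (y = a * x + b) := by
  have h1 : (1 : ℤ) ≤ 2 ^ n := one_le_pow₀ (by norm_num)
  have h2 : (2 : ℤ) ^ n ≤ (2 ^ n) ^ 2 := le_self_pow₀ h1 (by norm_num)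
  have hsub : Set.Icc (-(2 ^ n : ℤ)) (2 ^ n) ⊆ Set.Icc (-((2 : ℤ) ^ n) ^ 2) ((2 ^ n) ^ 2) :=
    Set.Icc_subset_Icc (neg_le_neg h2) h2
  have hdec : negPL n (clampPoint n x y) (clampLine n a b) = !decide
      (((clampPoint n x y).2 : ℤ) = (clampLine n a b).1 * (clampPoint n x y).1 +
        (clampLine n a b).2) := rfl
  rw [hdec]
  congr 1
  rw [decide_eq_decide]
  simp only [clampPoint, clampLine]
  rw [Set.projIcc_of_mem _ hx, Set.projIcc_of_mem _ hy, Set.projIcc_of_mem _ (hsub ha),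
    Set.projIcc_of_mem _ (hsub hb)]

open Finset in
theorem one_le_of_hasPublicCoinProtocol_negPL {n c K X : ℕ} (hK : 0 < K) (hX : 0 < X)
    (hn : K * X + K.factorial ≤ 2 ^ n) (h : HasPublicCoinProtocol (negPL n) c) :
    1 ≤ 180 * 4 ^ c * (1 / K + K.factorial / X : ℝ) := by
  set N : ℕ := 2 ^ n with hNdef
  have hNZ : (2 : ℤ) ^ n = N := by simp [hNdef]
  have hM : 0 < K.factorial := K.factorial_pos
  set M := K.factorial
  have hKX1 : K ≤ K * X := Nat.le_mul_of_pos_right _ hX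
  have hKX2 : X ≤ K * X := Nat.le_mul_of_pos_left _ hK
  set Q : ℝ := (X * N : ℝ) * ((4 * N + 1) * (4 * K * X + 4 * K ^ 2 * M)) with hQ
  have hrange : ∀ x < X, ∀ a < K, ∀ y ∈ Icc (1 : ℤ) N,
      (x + 1 : ℤ) ∈ Set.Icc (1 : ℤ) (2 ^ n) ∧ y ∈ Set.Icc (1 : ℤ) (2 ^ n) ∧
      (a + 1 : ℤ) ∈ Set.Icc (-(2 ^ n : ℤ)) (2 ^ n) ∧
      (y - (a + 1) * (x + 1)) ∈ Set.Icc (-(2 ^ n : ℤ)) (2 ^ n) ∧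
      (y - (a + 1) * (x + 1) - M) ∈ Set.Icc (-(2 ^ n : ℤ)) (2 ^ n) := by
    intro x hx a ha y hy
    have hax : (a + 1) * (x + 1) ≤ K * X := Nat.mul_le_mul ha hx
    have hax' : ((a : ℤ) + 1) * (x + 1) + M ≤ N := by exact_mod_cast (by omega : _ ≤ N)
    have hax0 : 0 ≤ ((a : ℤ) + 1) * (x + 1) := by positivity
    simp only [mem_Icc, Set.mem_Icc, hNZ] at hy ⊢
    omega
  have key := h.card_le_of_discrepancy (range X ×ˢ Icc (1 : ℤ) N ×ˢ range K)
    (fun z => clampPoint n (z.1 + 1) z.2.1)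
    (fun z => clampLine n (z.2.2 + 1) (z.2.1 - (z.2.2 + 1) * (z.1 + 1)))
    (fun z => clampLine n (z.2.2 + 1) (z.2.1 - (z.2.2 + 1) * (z.1 + 1) - M)) (√Q)
    (by
      rintro ⟨x, y, a⟩ hz
      simp only [mem_product, mem_range] at hz
      obtain ⟨h1, h2, h3, h4, h5⟩ := hrange x hz.1 a hz.2.2 y hz.2.1
      simp only [negPL_clamp n h1 h2 h3 h4, Bool.not_eq_false', decide_eq_true_eq]
      ring)
    (by
      rintro ⟨x, y, a⟩ hz
      simp only [mem_product, mem_range] at hz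
      obtain ⟨h1, h2, h3, h4, h5⟩ := hrange x hz.1 a hz.2.2 y hz.2.1
      simp only [negPL_clamp n h1 h2 h3 h5, Bool.not_eq_true', decide_eq_false_iff_not]
      intro heq
      have : (M : ℤ) = 0 := by linarith
      omega)
    (by
      intro p q
      refine Real.abs_le_sqrt ?_
      have hb := sq_sum_incidence_sub_le K X N hn
        (fun x y => if p (clampPoint n (x + 1) y) then 1 else 0)
        (fun a b => if b ∈ Icc (-(N : ℤ)) N then
          (if q (clampLine n (a + 1) b) then 1 else 0) else 0)
        (fun x y => by split_ifs <;> simp) (fun a b => by split_ifs <;> simp)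
        (fun a b hb => if_neg hb)
      refine le_of_eq_of_le ?_ hb
      congr 1
      simp only [sum_product]
      refine sum_congr rfl fun x hx => sum_congr rfl fun y hy => sum_congr rfl fun a ha => ?_
      obtain ⟨h1, h2, h3, h4, h5⟩ := hrange x (mem_range.1 hx) a (mem_range.1 ha) y hy
      rw [hNZ] at h4 h5
      rw [if_pos (mem_Icc.2 h4), if_pos (mem_Icc.2 h5)])
  have hcard : ((range X ×ˢ Icc (1 : ℤ) N ×ˢ range K).card : ℝ) = X * N * K := by
    simp [mul_assoc]
  rw [hcard] at key
  have hN1 : (1 : ℝ) ≤ N := by exact_mod_cast Nat.one_le_two_pow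
  have hK' : (0 : ℝ) < K := by exact_mod_cast hK
  have hX' : (0 : ℝ) < X := by exact_mod_cast hX
  have hM' : (0 : ℝ) < M := by exact_mod_cast hM
  have hQ0 : 0 ≤ Q := by positivity
  have hsq : (X * N * K / 3 : ℝ) ^ 2 ≤ 4 ^ c * Q := by
    calc (X * N * K / 3 : ℝ) ^ 2 ≤ (2 ^ c * √Q) ^ 2 := pow_le_pow_left₀ (by positivity) key 2
      _ = 4 ^ c * Q := by
        rw [mul_pow, Real.sq_sqrt hQ0, ← pow_mul, mul_comm c, pow_mul]
        norm_num
  have hQle : Q ≤ (X * N * K) ^ 2 * (20 * (1 / K + M / X)) := by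
    calc Q ≤ (X * N : ℝ) * ((5 * N) * (4 * K * X + 4 * K ^ 2 * M)) := by
          rw [hQ]
          gcongr
          linarith
      _ = _ := by
          field_simp
          ring
  have hpos : (0 : ℝ) < (X * N * K) ^ 2 := by positivity
  have h4 : (4 : ℝ) ^ c * Q ≤ 4 ^ c * ((X * N * K) ^ 2 * (20 * (1 / K + M / X))) := by gcongr
  have hfin : (X * N * K : ℝ) ^ 2 * 1 ≤ (X * N * K) ^ 2 * (180 * 4 ^ c * (1 / K + M / X)) := by
    nlinarith
  exact le_of_mul_le_mul_left hfin hpos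

theorem tendsto_randCC_negPL :
    Filter.Tendsto (fun n : ℕ => randCC (negPL n)) Filter.atTop Filter.atTop := by
  refine Filter.tendsto_atTop.2 fun c => ?_
  set K : ℕ := 400 * 4 ^ c with hKdef
  have hK : 0 < K := by positivity
  have hX : 0 < K.factorial * K := Nat.mul_pos K.factorial_pos hK
  filter_upwards [Filter.eventually_ge_atTop (K * (K.factorial * K) + K.factorial)] with n hn
  by_contra! hlt
  have hmem : HasPublicCoinProtocol (negPL n) (randCC (negPL n)) :=
    Nat.sInf_mem (exists_hasPublicCoinProtocol (negPL n))
  have h := one_le_of_hasPublicCoinProtocol_negPL hK hX (hn.trans n.lt_two_pow_self.le) hmem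
  have hM : (0 : ℝ) < K.factorial := by exact_mod_cast K.factorial_pos
  have hK' : (0 : ℝ) < K := by exact_mod_cast hK
  have hfrac : (K.factorial : ℝ) / (K.factorial * K : ℕ) = 1 / K := by
    push_cast
    field_simp
  rw [hfrac] at h
  have hpow : (4 : ℝ) ^ randCC (negPL n) ≤ 4 ^ c := pow_le_pow_right₀ (by norm_num) hlt.le
  have hKc : (K : ℝ) = 400 * 4 ^ c := by rw [hKdef]; push_cast; ring
  have h1 : (180 : ℝ) * 4 ^ randCC (negPL n) * (1 / K + 1 / K) ≤
      180 * 4 ^ c * (1 / K + 1 / K) := by gcongr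
  have h2 : (180 : ℝ) * 4 ^ c * (1 / K + 1 / K) = 9 / 10 := by
    rw [hKc]
    field_simp
    norm_num
  linarith

theorem isSupportRep_negPL (n : ℕ) :
    IsSupportRep (negPL n) (pointEmbedding n) (lineEmbedding n) := by
  intro p l
  simp only [negPL, PL, pointEmbedding, lineEmbedding, Matrix.vec3_dotProduct, Bool.not_eq_false',
    decide_eq_true_eq]
  rw [← @Int.cast_inj ℝ]
  simp only [Matrix.cons_val]
  push_cast
  constructor <;> intro h <;> linarith

theorem mainTheorem3 :
    (∀ n : ℕ, IsSupportRep (negPL n) (pointEmbedding n) (lineEmbedding n)) ∧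
    (∀ n : ℕ, supportRank (negPL n) ≤ 3) ∧
    Filter.Tendsto (fun n : ℕ => randCC (negPL n)) Filter.atTop Filter.atTop :=
  ⟨isSupportRep_negPL, fun n => sInf_le ⟨3, _, _, rfl, isSupportRep_negPL n⟩,
    tendsto_randCC_negPL⟩
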